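/- **Theorem.** Let $T[1..n]$ be a string over an integer alphabet $\{0,\dots,\sigma-1\}$ that is given online, letter by letter from left to right, on the word RAM with words of $w$ bits (where $n<2^w$ and $\sigma\le 2^w$). The *longest repeating suffix array* of $T$ is the array $\mathsf{LRS}[1..n]$ in which $\mathsf{LRS}[i]$ is the length of the longest suffix of $T[1..i]$ that occurs at least twice in $T[1..i]$. *SuffixUpdate* is the following task: when the $i$-th letter arrives, turn the suffix tree of the reversed string $T[i-1]\cdots T[1]$ into the suffix tree of $T[i]T[i-1]\cdots T[1]$. Here the suffix tree of a string $S$ is the compacted trie of all suffixes of $S$, whose nodes are the suffixes of $S$ (including the empty one, the root) and the branching substrings of $S$. It is kept in memory with a pointer to the root, a pointer to the leaf of the longest suffix, the text, and, for every other node, a pointer to its parent and the label of the edge from the parent, given by its length and a position in the text from which it is read. An implementation may keep any additional data (dictionaries of children, Weiner links, etc.). Then $\mathsf{LRS}$ can be computed online in $O(t_{\mathrm{SU}})$ worst-case time per letter, where $t_{\mathrm{SU}}$ is the worst-case time of SuffixUpdate. Precisely, there is an absolute constant $C$ such that the following holds. Suppose that a program solves SuffixUpdate online, on some class of word sizes $w$,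 text lengths $n$ and alphabet sizes $\sigma$ satisfying the inequalities above, in worst-case time at most $t_{\mathrm{SU}}(n,\sigma)$ per letter, having accessed at most $s(i)$ memory cells after $i$ letters, for every $1\le i\le n$. Then there is a program that, on the same class, spends at most $C\cdot t_{\mathrm{SU}}(n,\sigma)$ time on each letter, has $\mathsf{LRS}[1],\dots,\mathsf{LRS}[i]$ stored in an array in memory after the $i$-th letter, and has then accessed at most $C\cdot(s(i)+i)$ memory cells, for every $1\le i\le n$. (In particular it uses $O(i)$ words of space if SuffixUpdate does.) Receiving a letter counts as one step. -/

import Mathlib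

/-! ### Strings, the longest repeating suffix, suffix trees -/

namespace LRSOnline

/-- Number of occurrences of `u` in `T`, that is, of the starting positions
`p ∈ {0, …, |T|}` at which `u` can be read in `T`. -/
def occ {α : Type*} [DecidableEq α] (u T : List α) : ℕ :=
  ((Finset.range (T.length + 1)).filter (fun p => u <+: T.drop p)).card

/-- Length of the longest suffix of `T` that occurs at least twice in `T`
(the suffix of length `l` is `T.drop (|T| - l)`). The entry `LRS[i]` of the longest repeating
suffix array of `T` is `lrs (T.take i)`, for `1 ≤ i ≤ |T|`. -/
def lrs {α : Type*} [DecidableEq α] (T : List α) : ℕ :=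
  ((Finset.range (T.length + 1)).filter
    (fun l => 2 ≤ occ (T.drop (T.length - l)) T)).sup id

/-- The nodes of the suffix tree of `S`, each one identified with its label (the string spelled
out by the path from the root): the suffixes of `S` (among them the root `[]`), and the
branching substrings of `S`. Since a suffix that also occurs elsewhere is a node as well,
no end marker is needed. -/
def IsNode {α : Type*} (S u : List α) : Prop :=
  u <:+ S ∨ ∃ a b, a ≠ b ∧ (u ++ [a]) <:+: S ∧ (u ++ [b]) <:+: S

/-- `u` is the parent of `v` in the suffix tree of `S`: the longest proper prefix of `v` that
is a node. The edge from `u` to `v` is labelled with `v.drop u.length`. -/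
def IsParent {α : Type*} (S u v : List α) : Prop :=
  IsNode S v ∧ IsNode S u ∧ u <+: v ∧ u ≠ v ∧
    ∀ x, IsNode S x → x <+: v → x ≠ v → x.length ≤ u.length

/-! ### The word RAM with words of `w` bits -/

/-- The binary operations of the word RAM. -/
inductive BinOp
  | add | sub | mul | div | mod | and | or | xor | shl | shr | lt | eq

/-- Arithmetic is modulo `2 ^ w`; comparisons are unsigned and give `0` or `1`. -/
def BinOp.eval {w : ℕ} : BinOp → BitVec w → BitVec w → BitVec w
  | .add, x, y => x + y
  | .sub, x, y => x - y
  | .mul, x, y => x * y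
  | .div, x, y => x / y
  | .mod, x, y => x % y
  | .and, x, y => x &&& y
  | .or, x, y => x ||| y
  | .xor, x, y => x ^^^ y
  | .shl, x, y => x <<< y
  | .shr, x, y => x >>> y
  | .lt, x, y => if x.toNat < y.toNat then 1 else 0
  | .eq, x, y => if x = y then 1 else 0

/-- Instructions. Registers, memory arrays and jump targets are named by natural numbers;
a program, being finite, names finitely many registers and arrays.
`const r c` : `r := c`; `move r s` : `r := s`; `op o r a b` : `r := a o b`;
`load r k a` : `r := array k at address (content of a)`;
`store k a r` : `array k at address (content of a) := r`;
`jmp l` : go to instruction `l`; `jz r l` : go to instruction `l` if `r` holds `0`. -/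
inductive Instr
  | const (r c : ℕ)
  | move (r s : ℕ)
  | op (o : BinOp) (r a b : ℕ)
  | load (r k a : ℕ)
  | store (k a r : ℕ)
  | jmp (l : ℕ)
  | jz (r l : ℕ)

/-- A program does not depend on the word size. -/
abbrev Program := List Instr

/-- A configuration: program counter, registers, random access memory (finitely many arrays of
words are in use, each one addressed by words), and the set of the memory cells that have been
accessed so far; the last component only serves to measure space. -/
structure Config (w : ℕ) where
  pc : ℕ
  reg : ℕ → BitVec w
  mem : ℕ → BitVec w → BitVec w
  touched : Finset (ℕ × BitVec w)

/-- At the beginning, all registers and all memory cells hold `0`. -/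
def Config.init (w : ℕ) : Config w :=
  { pc := 0, reg := fun _ => 0, mem := fun _ _ => 0, touched := ∅ }

/-- The effect of one instruction. -/
def Instr.exec {w : ℕ} (c : Config w) : Instr → Config w
  | .const r v => { c with pc := c.pc + 1, reg := Function.update c.reg r (BitVec.ofNat w v) }
  | .move r s => { c with pc := c.pc + 1, reg := Function.update c.reg r (c.reg s) }
  | .op o r a b =>
      { c with pc := c.pc + 1, reg := Function.update c.reg r (o.eval (c.reg a) (c.reg b)) }
  | .load r k a =>
      { c with
        pc := c.pc + 1
        reg := Function.update c.reg r (c.mem k (c.reg a))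
        touched := insert (k, c.reg a) c.touched }
  | .store k a r =>
      { c with
        pc := c.pc + 1
        mem := Function.update c.mem k (Function.update (c.mem k) (c.reg a) (c.reg r))
        touched := insert (k, c.reg a) c.touched }
  | .jmp l => { c with pc := l }
  | .jz r l => { c with pc := if c.reg r = 0 then l else c.pc + 1 }

/-- One step; the machine halts when the program counter points outside the program. -/
def step {w : ℕ} (P : Program) (c : Config w) : Option (Config w) :=
  (P[c.pc]?).map (Instr.exec c)

/-- Exactly `k` steps (`none` if the machine halts earlier). -/
def steps {w : ℕ} (P : Program) : ℕ → Config w → Option (Config w)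
  | 0, c => some c
  | k + 1, c => (step P c).bind (steps P k)

/-- `P`, started in `c`, halts after exactly `k` steps, in `d`. -/
def HaltsIn {w : ℕ} (P : Program) (c : Config w) (k : ℕ) (d : Config w) : Prop :=
  steps P k c = some d ∧ step P d = none

/-- The next input letter is put into register `0`, and the program starts again at its first
instruction; all other registers and the memory are kept. -/
def deliver {w : ℕ} (c : Config w) (a : ℕ) : Config w :=
  { c with pc := 0, reg := Function.update c.reg 0 (BitVec.ofNat w a) }

/-- One round: `P` in configuration `c` receives the letter `a` and comes to rest in
configuration `d`, at the cost `k`. Receiving the letter costs one step. -/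
def Round {w : ℕ} (P : Program) (c : Config w) (a k : ℕ) (d : Config w) : Prop :=
  ∃ m, HaltsIn P (deliver c a) m d ∧ k = m + 1

/-- `P` reads the text `T` online, letter by letter, on the word RAM with `w`-bit words:
each round costs at most `t`; after the `i`-th round the configuration satisfies `Good i`, and
at most `s i` memory cells have been accessed. -/
def RunsOnline (w : ℕ) (P : Program) (T : List ℕ) (t : ℕ) (s : ℕ → ℕ)
    (Good : ℕ → Config w → Prop) : Prop :=
  ∃ cfg : ℕ → Config w, cfg 0 = Config.init w ∧
    ∀ (i : ℕ) (hi : i < T.length),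
      (∃ k, Round P (cfg i) T[i] k (cfg (i + 1)) ∧ k ≤ t) ∧
      Good (i + 1) (cfg (i + 1)) ∧
      (cfg (i + 1)).touched.card ≤ s (i + 1)

/-! ### The two problems -/

/-- Where an implementation keeps its suffix tree: the arrays for the text, the parent pointers,
and the start positions and lengths of the edge labels, and the registers that point to the root
and to the leaf of the longest suffix. -/
structure TreeLayout where
  text : ℕ
  parent : ℕ
  start : ℕ
  len : ℕ
  root : ℕ
  leaf : ℕ

/-- The configuration `c` holds the suffix tree of the reversal of the text `T`: there are pairwise
distinct words (pointers) for the nodes such that the two entry pointers are right, and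
for each edge `(u, v)` the parent pointer of `v` is the one of `u`, and the edge label is given by
its length and by a position `p ∈ {1, …, |T|}`, from which it is read off leftwards in the text:
`T[p], T[p-1], …`. Any further content (dictionaries of children, Weiner links, auxiliary
structures) is left to the implementation. -/
def HoldsSuffixTree {w : ℕ} (L : TreeLayout) (T : List ℕ) (c : Config w) : Prop :=
  (∀ (j : ℕ) (hj : j < T.length), (c.mem L.text (BitVec.ofNat w (j + 1))).toNat = T[j]) ∧
  ∃ ptr : List ℕ → BitVec w,
    Set.InjOn ptr {u | IsNode T.reverse u} ∧
    c.reg L.root = ptr [] ∧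
    c.reg L.leaf = ptr T.reverse ∧
    ∀ u v, IsParent T.reverse u v →
      c.mem L.parent (ptr v) = ptr u ∧
      (c.mem L.len (ptr v)).toNat = v.length - u.length ∧
      (c.mem L.start (ptr v)).toNat ≤ T.length ∧
      ((T.take (c.mem L.start (ptr v)).toNat).reverse).take (c.mem L.len (ptr v)).toNat
        = v.drop u.length

/-- `P` implements SuffixUpdate, with worst-case cost `t n σ` per letter and space `s i` after `i`
letters: reading a text `T` of length `n` over the alphabet `{0, …, σ - 1}` online, it turns, in
the `i`-th round, the suffix tree of the reversal of `T[1..i-1]` into the one of the reversal of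
`T[1..i]`. This is required for those word sizes, text lengths and alphabet sizes that are
admitted by `Adm`. -/
def ImplementsSuffixUpdate (Adm : ℕ → ℕ → ℕ → Prop) (t : ℕ → ℕ → ℕ) (s : ℕ → ℕ)
    (P : Program) (L : TreeLayout) : Prop :=
  ∀ w n σ, Adm w n σ → ∀ T : List ℕ, T.length = n → (∀ a ∈ T, a < σ) →
    RunsOnline w P T (t n σ) s (fun i c => HoldsSuffixTree L (T.take i) c)

/-- `Q` computes the longest repeating suffix array online, with worst-case cost `t n σ` per letter
and space `s i` after `i` letters: after the `i`-th round, the array `out` of its memory holds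
`LRS[1], …, LRS[i]` at the addresses `1, …, i`. -/
def ComputesLRSOnline (Adm : ℕ → ℕ → ℕ → Prop) (t : ℕ → ℕ → ℕ) (s : ℕ → ℕ)
    (Q : Program) (out : ℕ) : Prop :=
  ∀ w n σ, Adm w n σ → ∀ T : List ℕ, T.length = n → (∀ a ∈ T, a < σ) →
    RunsOnline w Q T (t n σ) s (fun i c =>
      ∀ j, 1 ≤ j → j ≤ i → (c.mem out (BitVec.ofNat w j)).toNat = lrs (T.take j))

end LRSOnline

/-! Let `S` be the reversal of `T`. A suffix of `T` occurs twice in `T` iff the corresponding prefix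
of `S` recurs in `S` at a positive position. Every node that is a proper prefix of `S` recurs
(`IsNode.repeatedPrefix`), and the longest recurring prefix is a node
(`RepeatedPrefix.isNode_of_not_succ`). So this prefix is the parent of the leaf `S`
(`isParent_take_lrs`), and `LRS[i]` is `i` minus the length of the edge to that leaf.

It therefore suffices to let five instructions follow each SuffixUpdate round: increment a letter
counter, load that edge length, subtract, store. They use fresh registers and a fresh array, so the
original run is undisturbed (`Simulates.exec`). -/

namespace LRSOnline

/-! ### The longest repeating suffix and the parent of the longest leaf -/

section Strings

variable {α : Type*}

/-- The prefix of length `l` of `S` also occurs in `S` at a positive position. -/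
def RepeatedPrefix (S : List α) (l : ℕ) : Prop :=
  ∃ y x, y ≠ [] ∧ S = y ++ S.take l ++ x

/-- One occurrence is the suffix itself; any other starts elsewhere, hence earlier, and leaves a
nonempty remainder `y`. -/
theorem two_le_occ_iff [DecidableEq α] {u T : List α} (hu : u <:+ T) :
    2 ≤ occ u T ↔ ∃ x y, y ≠ [] ∧ T = x ++ u ++ y := by
  obtain ⟨z, rfl⟩ := hu
  have hz : z.length ∈ (Finset.range ((z ++ u).length + 1)).filter
      (fun p => u <+: (z ++ u).drop p) := by
    simp
  constructor
  · intro h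
    obtain ⟨p, hp, hne⟩ := Finset.exists_mem_ne (Nat.lt_of_succ_le h) z.length
    rw [Finset.mem_filter, Finset.mem_range] at hp
    obtain ⟨hp, y, hy⟩ := hp
    refine ⟨(z ++ u).take p, y, ?_, ?_⟩
    · rintro rfl
      have := congrArg List.length hy
      simp only [List.length_append, List.length_drop, List.length_nil] at this hp
      omega
    · rw [List.append_assoc, hy, List.take_append_drop]
  · rintro ⟨x, y, hy, hT⟩
    have hlen := congrArg List.length hT
    simp only [List.length_append] at hlen
    have hpos := List.length_pos_iff.mpr hy
    refine Nat.succ_le_of_lt (Finset.one_lt_card.mpr ⟨z.length, hz, x.length, ?_, by omega⟩)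
    rw [Finset.mem_filter, Finset.mem_range]
    refine ⟨by simp only [List.length_append]; omega, ?_⟩
    rw [hT, List.append_assoc, List.drop_left]
    exact List.prefix_append _ _

theorem two_le_occ_drop_iff [DecidableEq α] {T : List α} {l : ℕ} :
    2 ≤ occ (T.drop (T.length - l)) T ↔ RepeatedPrefix T.reverse l := by
  rw [two_le_occ_iff (List.drop_suffix _ _)]
  have key : T.reverse.take l = (T.drop (T.length - l)).reverse := List.take_reverse
  constructor
  · rintro ⟨x, y, hy, h⟩
    refine ⟨y.reverse, x.reverse, by simpa using hy, ?_⟩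
    rw [key]
    conv_lhs => rw [h]
    simp
  · rintro ⟨y, x, hy, h⟩
    refine ⟨x.reverse, y.reverse, by simpa using hy, ?_⟩
    rw [key] at h
    have := congrArg List.reverse h
    rw [List.reverse_reverse] at this
    conv_lhs => rw [this]
    simp

theorem RepeatedPrefix.lt_length {S : List α} {l : ℕ} (hS : S ≠ []) (h : RepeatedPrefix S l) :
    l < S.length := by
  obtain ⟨y, x, hy, h⟩ := h
  have hlen := congrArg List.length h
  have h1 := List.length_pos_iff.mpr hy
  have h2 := List.length_pos_iff.mpr hS
  simp only [List.length_append, List.length_take] at hlen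
  omega

theorem repeatedPrefix_zero {S : List α} (hS : S ≠ []) : RepeatedPrefix S 0 :=
  ⟨S, [], hS, by simp⟩

/-- A proper suffix starts at a positive position. A branching word has two different continuations,
and position 0 admits only one of them. -/
theorem IsNode.repeatedPrefix {S v : List α} (hv : IsNode S v) (hp : v <+: S) (hne : v ≠ S) :
    RepeatedPrefix S v.length := by
  have htake : S.take v.length = v := (List.prefix_iff_eq_take.mp hp).symm
  rw [RepeatedPrefix, htake]
  rcases hv with ⟨y, hy⟩ | ⟨a, b, hab, ⟨y, x, ha⟩, ⟨y', x', hb⟩⟩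
  · refine ⟨y, [], ?_, by simp [hy]⟩
    rintro rfl
    exact hne (by simpa using hy)
  · by_cases h : y = []
    · by_cases h' : y' = []
      · subst h h'
        rw [← hb] at ha
        simp only [List.nil_append, List.append_assoc, List.append_cancel_left_eq,
          List.singleton_append, List.cons.injEq] at ha
        exact absurd ha.1 hab
      · exact ⟨y', b :: x', h', by simp [← hb]⟩
    · exact ⟨y, a :: x, h, by simp [← ha]⟩

/-- Either the second occurrence ends where `S` ends, or its next letter differs from `S[l]`:
equality would make the prefix of length `l + 1` recur. -/
theorem RepeatedPrefix.isNode_of_not_succ {S : List α} {l : ℕ} (hS : S ≠ [])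
    (h : RepeatedPrefix S l) (hmax : ¬ RepeatedPrefix S (l + 1)) : IsNode S (S.take l) := by
  have hl := h.lt_length hS
  obtain ⟨y, x, hy, h⟩ := h
  have hsucc : S.take l ++ [S[l]] = S.take (l + 1) := List.take_append_getElem hl
  cases x with
  | nil => exact Or.inl ⟨y, by simpa using h.symm⟩
  | cons a x =>
    refine Or.inr ⟨a, S[l], ?_, ⟨y, x, by simpa using h.symm⟩, ?_⟩
    · intro hab
      refine hmax ⟨y, x, hy, ?_⟩
      rw [← hsucc, ← hab]
      simpa using h
    · rw [hsucc]
      exact (List.take_prefix _ _).isInfix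

variable [DecidableEq α]

theorem RepeatedPrefix.le_lrs {T : List α} {l : ℕ} (hT : T ≠ [])
    (h : RepeatedPrefix T.reverse l) : l ≤ lrs T := by
  have hl := h.lt_length (by simpa using hT)
  rw [List.length_reverse] at hl
  refine Finset.le_sup (f := id) (Finset.mem_filter.mpr ⟨?_, two_le_occ_drop_iff.mpr h⟩)
  rw [Finset.mem_range]
  omega

theorem repeatedPrefix_lrs {T : List α} (hT : T ≠ []) : RepeatedPrefix T.reverse (lrs T) := by
  -- The supremum is attained only over a nonempty set; the empty suffix of a nonempty `T` is a
  -- member.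
  have hne : ((Finset.range (T.length + 1)).filter
      (fun l => 2 ≤ occ (T.drop (T.length - l)) T)).Nonempty :=
    ⟨0, Finset.mem_filter.mpr ⟨by simp, two_le_occ_drop_iff.mpr
      (repeatedPrefix_zero (by simpa using hT))⟩⟩
  obtain ⟨l, hl, heq⟩ := Finset.exists_mem_eq_sup _ hne id
  rw [lrs, heq]
  exact two_le_occ_drop_iff.mp (Finset.mem_filter.mp hl).2

theorem lrs_lt_length {T : List α} (hT : T ≠ []) : lrs T < T.length := by
  simpa using (repeatedPrefix_lrs hT).lt_length (by simpa using hT)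

/-- The longest repeating suffix of `T`, reversed, is the parent of the leaf of the longest suffix
in the suffix tree of the reversal of `T`. -/
theorem isParent_take_lrs {T : List α} (hT : T ≠ []) :
    IsParent T.reverse (T.reverse.take (lrs T)) T.reverse := by
  have hS : T.reverse ≠ [] := by simpa using hT
  have hlt := lrs_lt_length hT
  refine ⟨Or.inl List.suffix_rfl,
    (repeatedPrefix_lrs hT).isNode_of_not_succ hS fun h => ?_, List.take_prefix _ _, ?_, ?_⟩
  · have := h.le_lrs hT
    omega
  · intro h
    have := congrArg List.length h
    simp only [List.length_take, List.length_reverse] at this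
    omega
  · intro x hx hp hne
    have := (hx.repeatedPrefix hp hne).le_lrs hT
    simp only [List.length_take, List.length_reverse]
    omega

end Strings

theorem HoldsSuffixTree.len_leaf {w : ℕ} {L : TreeLayout} {T : List ℕ} {c : Config w}
    (h : HoldsSuffixTree L T c) (hT : T ≠ []) :
    (c.mem L.len (c.reg L.leaf)).toNat = T.length - lrs T := by
  obtain ⟨-, ptr, -, -, hleaf, hpar⟩ := h
  have hlt := lrs_lt_length hT
  rw [hleaf, (hpar _ _ (isParent_take_lrs hT)).2.1]
  simp only [List.length_take, List.length_reverse]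
  omega

/-! ### Running further code after a program -/

theorem steps_add {w : ℕ} {P : Program} {a b : ℕ} {c d : Config w} (h : steps P a c = some d) :
    steps P (a + b) c = steps P b d := by
  induction a generalizing c with
  | zero =>
    obtain rfl : c = d := by simpa [steps] using h
    rw [Nat.zero_add]
  | succ a ih =>
    obtain ⟨e, he, hd⟩ := Option.bind_eq_some_iff.mp h
    rw [Nat.add_right_comm, steps, he]
    exact ih hd

/-- All registers and arrays named by the instruction are below `B`. -/
def Instr.Below (B : ℕ) : Instr → Prop
  | .const r _ => r < B
  | .move r s => r < B ∧ s < B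
  | .op _ r a b => r < B ∧ a < B ∧ b < B
  | .load r k a => r < B ∧ k < B ∧ a < B
  | .store k a r => k < B ∧ a < B ∧ r < B
  | .jmp _ => True
  | .jz r _ => r < B

theorem Instr.Below.mono {B B' : ℕ} (h : B ≤ B') {I : Instr} (hI : I.Below B) : I.Below B' := by
  cases I <;> simp only [Instr.Below] at hI ⊢ <;> omega

theorem Instr.exists_below (I : Instr) : ∃ B, I.Below B := by
  cases I with
  | const r _ => exact ⟨r + 1, by simp [Instr.Below]⟩
  | move r s => exact ⟨r + s + 1, by simp only [Instr.Below]; omega⟩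
  | op _ r a b => exact ⟨r + a + b + 1, by simp only [Instr.Below]; omega⟩
  | load r k a => exact ⟨r + k + a + 1, by simp only [Instr.Below]; omega⟩
  | store k a r => exact ⟨r + k + a + 1, by simp only [Instr.Below]; omega⟩
  | jmp _ => exact ⟨0, trivial⟩
  | jz r _ => exact ⟨r + 1, by simp [Instr.Below]⟩

/-- Provides fresh names for the added code; `B₀` keeps the layout's own registers and arrays below
`B` too. -/
theorem Program.exists_below (P : Program) (B₀ : ℕ) :
    ∃ B, B₀ ≤ B ∧ ∀ I ∈ P, I.Below B := by
  induction P with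
  | nil => exact ⟨B₀, le_rfl, by simp⟩
  | cons I P ih =>
    obtain ⟨B, hB, hP⟩ := ih
    obtain ⟨B', hI⟩ := I.exists_below
    refine ⟨max B B', by omega, fun J hJ => ?_⟩
    rcases List.mem_cons.mp hJ with rfl | hJ
    · exact hI.mono (le_max_right _ _)
    · exact (hP J hJ).mono (le_max_left _ _)

/-- Jumps beyond `n` are redirected to `n`. -/
def Instr.clampJump (n : ℕ) : Instr → Instr
  | .jmp l => .jmp (min l n)
  | .jz r l => .jz r (min l n)
  | I => I

/-- Run `P`, and then `E`. -/
def Program.followedBy (P E : Program) : Program :=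
  P.map (Instr.clampJump P.length) ++ E

/-- `c'` simulates the configuration `c` of a program of length `n` that uses only registers
and arrays below `B`: register `B` holds `x`, array `B` holds `m`, and the cells `A` have been
accessed in addition. -/
structure Simulates {w : ℕ} (n B : ℕ) (x : BitVec w) (m : BitVec w → BitVec w)
    (A : Finset (ℕ × BitVec w)) (c c' : Config w) : Prop where
  pc : c'.pc = min c.pc n
  reg : ∀ r < B, c'.reg r = c.reg r
  mem : ∀ k < B, c'.mem k = c.mem k
  touched : c'.touched = c.touched ∪ A
  counter : c'.reg B = x
  out : c'.mem B = m

section Simulation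

variable {w n B : ℕ} {x : BitVec w} {m : BitVec w → BitVec w} {A : Finset (ℕ × BitVec w)}
  {c c' d : Config w}

theorem update_agree {β : Type*} {f f' : ℕ → β} {r : ℕ} {b b' : β}
    (h : ∀ q < B, f' q = f q) (hb : b' = b) :
    ∀ q < B, Function.update f' r b' q = Function.update f r b q := by
  intro q hq
  subst hb
  rcases eq_or_ne q r with rfl | hqr
  · simp
  · rw [Function.update_of_ne hqr, Function.update_of_ne hqr, h q hq]

/-- An instruction below `B` reads only where the two configurations agree, and never writes to
register `B` or array `B`. -/
theorem Simulates.exec (h : Simulates n B x m A c c') {I : Instr} (hI : I.Below B)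
    (hpc : c.pc < n) : Simulates n B x m A (I.exec c) ((I.clampJump n).exec c') := by
  obtain ⟨h1, h2, h3, h4, h5, h6⟩ := h
  have hpc' : c'.pc + 1 = min (c.pc + 1) n := by omega
  cases I with
  | const r v =>
    simp only [Instr.Below] at hI
    exact ⟨hpc', update_agree h2 rfl, h3, h4, by
      simpa [Instr.clampJump, Instr.exec, Function.update_of_ne hI.ne'] using h5, h6⟩
  | move r s =>
    obtain ⟨hr, hs⟩ := hI
    exact ⟨hpc', update_agree h2 (h2 s hs), h3, h4, by
      simpa [Instr.clampJump, Instr.exec, Function.update_of_ne hr.ne'] using h5, h6⟩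
  | op o r a b =>
    obtain ⟨hr, ha, hb⟩ := hI
    exact ⟨hpc', update_agree h2 (by rw [h2 a ha, h2 b hb]), h3, h4, by
      simpa [Instr.clampJump, Instr.exec, Function.update_of_ne hr.ne'] using h5, h6⟩
  | load r k a =>
    obtain ⟨hr, hk, ha⟩ := hI
    exact ⟨hpc', update_agree h2 (by rw [h2 a ha, h3 k hk]), h3, by
      simp [Instr.clampJump, Instr.exec, h4, h2 a ha], by
      simpa [Instr.clampJump, Instr.exec, Function.update_of_ne hr.ne'] using h5, h6⟩
  | store k a r =>
    obtain ⟨hk, ha, hr⟩ := hI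
    exact ⟨hpc', h2, update_agree h3 (by rw [h2 a ha, h2 r hr, h3 k hk]), by
      simp [Instr.clampJump, Instr.exec, h4, h2 a ha], h5, by
      simpa [Instr.clampJump, Instr.exec, Function.update_of_ne hk.ne'] using h6⟩
  | jmp l => exact ⟨rfl, h2, h3, h4, h5, h6⟩
  | jz r l =>
    refine ⟨?_, h2, h3, h4, h5, h6⟩
    simp only [Instr.clampJump, Instr.exec, h2 r hI]
    split_ifs
    · rfl
    · exact hpc'

theorem Simulates.step {P E : Program} (hP : ∀ I ∈ P, I.Below B)
    (h : Simulates P.length B x m A c c') (hd : step P c = some d) :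
    ∃ d', LRSOnline.step (P.followedBy E) c' = some d' ∧ Simulates P.length B x m A d d' := by
  obtain ⟨I, hI, rfl⟩ := Option.map_eq_some_iff.mp hd
  obtain ⟨hpc, rfl⟩ := List.getElem?_eq_some_iff.mp hI
  refine ⟨_, ?_, h.exec (hP _ (List.getElem_mem hpc)) hpc⟩
  have hpc' : c'.pc = c.pc := by rw [h.pc]; omega
  simp [LRSOnline.step, Program.followedBy, hpc', List.getElem?_append_left, hpc]

theorem Simulates.steps {P E : Program} (hP : ∀ I ∈ P, I.Below B) {k : ℕ}
    (h : Simulates P.length B x m A c c') (hd : steps P k c = some d) :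
    ∃ d', LRSOnline.steps (P.followedBy E) k c' = some d' ∧
      Simulates P.length B x m A d d' := by
  induction k generalizing c c' with
  | zero =>
    obtain rfl : c = d := by simpa [LRSOnline.steps] using hd
    exact ⟨c', rfl, h⟩
  | succ k ih =>
    obtain ⟨e, he, hd⟩ := Option.bind_eq_some_iff.mp hd
    obtain ⟨e', he', hsim⟩ := h.step (E := E) hP he
    obtain ⟨d', hd', hsim'⟩ := ih hsim hd
    exact ⟨d', by rw [LRSOnline.steps, he']; exact hd', hsim'⟩

/-- `P` may halt by jumping anywhere past its end; clamping sends all such targets to the first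
instruction of the appended code. -/
theorem Simulates.pc_of_halted {P : Program} (h : Simulates P.length B x m A c c')
    (hc : LRSOnline.step P c = none) : c'.pc = P.length := by
  have : P.length ≤ c.pc := by simpa [LRSOnline.step] using hc
  rw [h.pc]
  omega

theorem Simulates.deliver (hB : 0 < B) (h : Simulates n B x m A c c') (a : ℕ) :
    Simulates n B x m A (deliver c a) (deliver c' a) :=
  ⟨by simp [LRSOnline.deliver], update_agree h.reg rfl, h.mem, h.touched, by
    simpa [LRSOnline.deliver, Function.update_of_ne hB.ne'] using h.counter, h.out⟩

end Simulation

/-! ### Reading off the longest repeating suffix -/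

/-- Register `B` counts the letters; its content minus the length of the edge to the leaf of the
longest suffix is appended to array `B`. -/
def appendLRS (L : TreeLayout) (B : ℕ) : Program :=
  [.const (B + 1) 1,
   .op .add B B (B + 1),
   .load (B + 1) L.len L.leaf,
   .op .sub (B + 1) B (B + 1),
   .store B B (B + 1)]

/-- The configuration reached from `c` by running `appendLRS L B`. -/
def afterAppendLRS {w : ℕ} (L : TreeLayout) (B : ℕ) (c : Config w) : Config w :=
  let x := c.reg B + 1
  let y := x - c.mem L.len (c.reg L.leaf)
  { pc := c.pc + 5
    reg := Function.update (Function.update c.reg B x) (B + 1) y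
    mem := Function.update c.mem B (Function.update (c.mem B) x y)
    touched := insert (B, x) (insert (L.len, c.reg L.leaf) c.touched) }

theorem haltsIn_appendLRS {w : ℕ} {L : TreeLayout} {B : ℕ} (P : Program) (hleaf : L.leaf < B)
    {c : Config w} (hpc : c.pc = P.length) :
    HaltsIn (P.followedBy (appendLRS L B)) c 5 (afterAppendLRS L B c) := by
  obtain ⟨pc, reg, mem, touched⟩ := c
  obtain rfl : pc = P.length := hpc
  have hget (i : ℕ) : (P.followedBy (appendLRS L B))[P.length + i]? = (appendLRS L B)[i]? := by
    rw [Program.followedBy, List.getElem?_append_right (by simp)]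
    simp
  have h0 : (P.followedBy (appendLRS L B))[P.length]? = some (.const (B + 1) 1) := hget 0
  have h1 : (P.followedBy (appendLRS L B))[P.length + 1]? = some (.op .add B B (B + 1)) := hget 1
  have h2 : (P.followedBy (appendLRS L B))[P.length + 2]? = some (.load (B + 1) L.len L.leaf) :=
    hget 2
  have h3 : (P.followedBy (appendLRS L B))[P.length + 3]? = some (.op .sub (B + 1) B (B + 1)) :=
    hget 3
  have h4 : (P.followedBy (appendLRS L B))[P.length + 4]? = some (.store B B (B + 1)) := hget 4
  have h5 : (P.followedBy (appendLRS L B))[P.length + 5]? = none := hget 5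
  have hl : L.leaf ≠ B := hleaf.ne
  have hl' : L.leaf ≠ B + 1 := by omega
  constructor
  · simp only [steps, step, h0, h1, h2, h3, h4, Instr.exec, Option.map_some, Option.bind_some,
      Nat.add_assoc, Nat.reduceAdd]
    simp only [afterAppendLRS, BinOp.eval, Function.update_self, Option.some.injEq,
      Config.mk.injEq, true_and, ne_eq, hl, hl', not_false_eq_true, Function.update_of_ne,
      one_ne_zero, Nat.left_eq_add]
    refine ⟨?_, rfl, rfl⟩
    -- Register `B + 1` is scratch: it is written three times, and only the last value remains.
    funext r
    by_cases h1 : r = B + 1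
    · simp [h1]
    · by_cases h2 : r = B <;> simp [h1, h2]
  · simp only [step, afterAppendLRS, h5, Option.map_none]

/-- The configurations of the constructed program after `i` letters. -/
def LRSInvariant {w : ℕ} (n B : ℕ) (T : List ℕ) (i : ℕ) (c c' : Config w) : Prop :=
  (∃ A m, A.card ≤ 2 * i ∧ Simulates n B (BitVec.ofNat w i) m A { c with pc := 0 }
    { c' with pc := 0 }) ∧
  ∀ j, 1 ≤ j → j ≤ i → (c'.mem B (BitVec.ofNat w j)).toNat = lrs (T.take j)

theorem LRSInvariant.init (w n B : ℕ) (T : List ℕ) :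
    LRSInvariant n B T 0 (Config.init w) (Config.init w) := by
  refine ⟨⟨∅, fun _ => 0, by simp, ?_⟩, fun j h1 h2 => by omega⟩
  constructor <;> simp [Config.init]

theorem LRSInvariant.card_touched_le {w n B : ℕ} {T : List ℕ} {i : ℕ} {c c' : Config w}
    (h : LRSInvariant n B T i c c') : c'.touched.card ≤ c.touched.card + 2 * i := by
  obtain ⟨⟨A, m, hA, hsim⟩, -⟩ := h
  have ht : c'.touched = c.touched ∪ A := hsim.touched
  rw [ht]
  exact (Finset.card_union_le _ _).trans (by omega)

theorem LRSInvariant.round {w B : ℕ} {T : List ℕ} {i k a : ℕ} {c d c' : Config w}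
    {P : Program} {L : TreeLayout} (hP : ∀ I ∈ P, I.Below B) (hlen : L.len < B)
    (hleaf : L.leaf < B) (hw : i + 1 < 2 ^ w) (hi : i + 1 ≤ T.length)
    (h : LRSInvariant P.length B T i c c') (hr : Round P c a k d)
    (hd : HoldsSuffixTree L (T.take (i + 1)) d) :
    ∃ d', Round (P.followedBy (appendLRS L B)) c' a (k + 5) d' ∧
      LRSInvariant P.length B T (i + 1) d d' := by
  obtain ⟨⟨A, m, hA, hsim⟩, hout⟩ := h
  obtain ⟨q, ⟨hq, hhalt⟩, rfl⟩ := hr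
  -- The resting program counters differ, but `deliver` overwrites them, so the invariant with
  -- counters reset to 0 suffices.
  have hsim' : Simulates P.length B (BitVec.ofNat w i) m A (deliver c a) (deliver c' a) :=
    hsim.deliver (by omega) a
  obtain ⟨e, he, hse⟩ := hsim'.steps (E := appendLRS L B) hP hq
  have hE := haltsIn_appendLRS P hleaf (hse.pc_of_halted hhalt)
  have hm : m = c'.mem B := hsim.out.symm
  have hTne : T.take (i + 1) ≠ [] := by
    rw [← List.length_pos_iff, List.length_take]
    omega
  have hTlen : (T.take (i + 1)).length = i + 1 := by
    rw [List.length_take]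
    omega
  have hx : e.reg B + 1 = BitVec.ofNat w (i + 1) := by
    rw [hse.counter, BitVec.ofNat_add]
    rfl
  -- Needed for `i + 1 - (i + 1 - lrs) = lrs` in truncated subtraction.
  have hlrs := lrs_lt_length hTne
  have hy : (e.reg B + 1 - e.mem L.len (e.reg L.leaf)).toNat = lrs (T.take (i + 1)) := by
    have hl := hd.len_leaf hTne
    have hxn : (BitVec.ofNat w (i + 1)).toNat = i + 1 := by
      rw [BitVec.toNat_ofNat, Nat.mod_eq_of_lt hw]
    rw [hx, hse.mem _ hlen, hse.reg _ hleaf, BitVec.toNat_sub_of_le, hl, hxn]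
    · omega
    · rw [BitVec.le_def, hl, hxn]
      omega
  refine ⟨afterAppendLRS L B e, ⟨q + 5, ⟨?_, hE.2⟩, by omega⟩,
    ⟨insert (B, e.reg B + 1) (insert (L.len, e.reg L.leaf) A), _, ?_,
      ⟨(Nat.zero_min _).symm, ?_, ?_, ?_, ?_, rfl⟩⟩, ?_⟩
  · rw [steps_add he]
    exact hE.1
  · have h1 := Finset.card_insert_le (B, e.reg B + 1) (insert (L.len, e.reg L.leaf) A)
    have h2 := Finset.card_insert_le (L.len, e.reg L.leaf) A
    omega
  · intro r hr
    have h1 : r ≠ B := by omega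
    have h2 : r ≠ B + 1 := by omega
    simpa [afterAppendLRS, h1, h2] using hse.reg r hr
  · intro r hr
    have h1 : r ≠ B := by omega
    simpa [afterAppendLRS, h1] using hse.mem r hr
  · simp [afterAppendLRS, hse.touched]
  · simpa [afterAppendLRS] using hx
  · intro j h1 h2
    rcases eq_or_ne j (i + 1) with rfl | hj
    · simpa only [afterAppendLRS, Function.update_self, ← hx] using hy
    -- As `i + 1 < 2 ^ w`, addresses do not wrap around, and earlier entries survive.
    · have hne : BitVec.ofNat w j ≠ e.reg B + 1 := by
        rw [hx]
        intro heq
        have := congrArg BitVec.toNat heq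
        rw [BitVec.toNat_ofNat, BitVec.toNat_ofNat, Nat.mod_eq_of_lt hw,
          Nat.mod_eq_of_lt (by omega)] at this
        exact hj this
      simp only [afterAppendLRS, Function.update_self, Function.update_of_ne hne]
      rw [hse.out, hm]
      exact hout j h1 (by omega)

/-- `RunsOnline` asks for a whole sequence of configurations; this glues single rounds together by
dependent choice. -/
theorem exists_sequence_of_step {β : Type*} {N : ℕ} {p : ℕ → β → Prop} {r : ℕ → β → β → Prop}
    {b₀ : β} (h₀ : p 0 b₀) (h : ∀ i < N, ∀ b, p i b → ∃ b', p (i + 1) b' ∧ r i b b') :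
    ∃ f : ℕ → β, f 0 = b₀ ∧ ∀ i < N, p (i + 1) (f (i + 1)) ∧ r i (f i) (f (i + 1)) := by
  classical
  choose! g hg using h
  let f : ℕ → β := fun i => Nat.rec b₀ (fun i b => g i b) i
  have hf (i : ℕ) (hi : i ≤ N) : p i (f i) := by
    induction i with
    | zero => exact h₀
    | succ i ih => exact (hg i hi _ (ih (by omega))).1
  exact ⟨f, rfl, fun i hi => hg i hi _ (hf i hi.le)⟩

theorem RunsOnline.appendLRS {w B : ℕ} {P : Program} {L : TreeLayout} {T : List ℕ} {t : ℕ}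
    {s : ℕ → ℕ} (hP : ∀ I ∈ P, I.Below B) (hlen : L.len < B) (hleaf : L.leaf < B)
    (hw : T.length < 2 ^ w)
    (h : RunsOnline w P T t s (fun i c => HoldsSuffixTree L (T.take i) c)) :
    RunsOnline w (P.followedBy (LRSOnline.appendLRS L B)) T (6 * t) (fun i => 6 * (s i + i))
      (fun i c => ∀ j, 1 ≤ j → j ≤ i → (c.mem B (BitVec.ofNat w j)).toNat = lrs (T.take j)) := by
  obtain ⟨cfg, h0, hcfg⟩ := h
  obtain ⟨f, hf0, hf⟩ := exists_sequence_of_step (N := T.length)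
    (p := fun i c' => LRSInvariant P.length B T i (cfg i) c')
    (r := fun i c' d' => ∀ hi : i < T.length,
      ∃ k, Round (P.followedBy (LRSOnline.appendLRS L B)) c' T[i] k d' ∧ k ≤ 6 * t)
    (b₀ := Config.init w) (by rw [h0]; exact LRSInvariant.init w _ B T) (by
      intro i hi c' hc'
      obtain ⟨⟨k, hk, hkt⟩, hgood, -⟩ := hcfg i hi
      obtain ⟨d', hround, hinv⟩ := hc'.round hP hlen hleaf (by omega) hi hk hgood
      refine ⟨d', hinv, fun _ => ⟨k + 5, hround, ?_⟩⟩
      -- Receiving the letter costs a step, so `k ≥ 1` and `k + 5 ≤ 6 * k`; hence the constant 6.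
      obtain ⟨q, -, rfl⟩ := hk
      omega)
  refine ⟨f, hf0, fun i hi => ⟨(hf i hi).2 hi, (hf i hi).1.2, ?_⟩⟩
  have h1 := (hf i hi).1.card_touched_le
  have h2 := (hcfg i hi).2.2
  simp only
  omega

end LRSOnline

theorem mainTheorem1 :
    ∃ C : ℕ, ∀ (Adm : ℕ → ℕ → ℕ → Prop),
      (∀ w n σ, Adm w n σ → n < 2 ^ w ∧ σ ≤ 2 ^ w) →
      ∀ (tSU : ℕ → ℕ → ℕ) (s : ℕ → ℕ) (P : LRSOnline.Program) (L : LRSOnline.TreeLayout),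
        LRSOnline.ImplementsSuffixUpdate Adm tSU s P L →
        ∃ (Q : LRSOnline.Program) (out : ℕ),
          LRSOnline.ComputesLRSOnline Adm
            (fun n σ => C * tSU n σ) (fun i => C * (s i + i)) Q out := by
  refine ⟨6, fun Adm hAdm tSU s P L hP => ?_⟩
  obtain ⟨B, hB, hbelow⟩ := LRSOnline.Program.exists_below P (L.len + L.leaf + 1)
  refine ⟨P.followedBy (LRSOnline.appendLRS L B), B, fun w n σ hadm T hT hσ => ?_⟩
  exact (hP w n σ hadm T hT hσ).appendLRS hbelow (by omega) (by omega)
    (by rw [hT]; exact (hAdm w n σ hadm).1)
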